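/- **Matrix Liberation Lemma.** All matrices are real. For a graph $G$ (simple, undirected) with vertex set $\{1,\dots,n\}$, let $\mathcal S(G)$ be the set of symmetric $n\times n$ matrices $A=[a_{ij}]$ such that, for all $i\ne j$, $a_{ij}\neq 0$ if and only if $ij$ is an edge of $G$; the diagonal is unrestricted. Let $\overline G$ be the complement of $G$ and $\overline E=\{(i,j): i<j,\ \{i,j\}\in E(\overline G)\}$. Let $\circ$ denote the entrywise product and $[A,X]=AX-XA$. A symmetric $n\times n$ matrix $A$ has * the *SSP* if $X=O$ is the only symmetric matrix $X$ with $A\circ X=O$, $I\circ X=O$ and $[A,X]=O$; * the *SMP* if $X=O$ is the only symmetric matrix $X$ with $A\circ X=O$, $I\circ X=O$, $[A,X]=O$ and $\operatorname{tr}(A^iX)=0$ for $i=2,\dots,n-1$; * the *SAP* if $X=O$ is the only symmetric matrix $X$ with $A\circ X=O$, $I\circ X=O$ and $AX=O$. The *spectrum* of $A$ is the multiset of its eigenvalues. If $\lambda_1<\dots<\lambda_q$ are the distinct eigenvalues of $A$, with multiplicities $m_1,\dots,m_q$, its *ordered multiplicity list* is $(m_1,\dots,m_q)$. Let $E_{k\ell}$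 be the matrix whose only nonzero entry is a $1$ in position $(k,\ell)$, let $K_{k\ell}=E_{k\ell}-E_{\ell k}$, and for a symmetric matrix $M$ let $\operatorname{vec}_{\overline E}(M)$ be the vector of entries $M_{ij}$, $(i,j)\in\overline E$. For $A\in\mathcal S(G)$ with $q$ distinct eigenvalues, define the *verification matrices*, with rows indexed by $\overline E$: * $\Psi_S(A)$ has the columns $\operatorname{vec}_{\overline E}(AK_{k\ell}+K_{\ell k}A)$, $1\le k<\ell\le n$; * $\Psi_M(A)$ is $\Psi_S(A)$ augmented with the $q$ columns $\operatorname{vec}_{\overline E}(A^k)$, $k=0,1,\dots,q-1$; * $\Psi_A(A)$ has the columns $\operatorname{vec}_{\overline E}(AE_{k\ell}+E_{\ell k}A)$, $1\le k,\ell\le n$. Let $G$ be a graph on $\{1,\dots,n\}$, let $A\in\mathcal S(G)$, and let $\Psi$ be $\Psi_S(A)$ (Case 1), $\Psi_M(A)$ (Case 2) or $\Psi_A(A)$ (Case 3). Suppose that $x\in\mathbb R^{\overline E}$ lies in the column space of $\Psi$ and that the rows of $\Psi$ indexed by the complement of $\operatorname{supp}(x)=\{e\in\overline E: x_e\ne0\}$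 are linearly independent. Let $H$ be the spanning subgraph of $\overline G$ whose edges are the $\{i,j\}$ with $(i,j)\in\operatorname{supp}(x)$. Then $A$ can be perturbed to a matrix $A'\in\mathcal S(G\cup H)$, that is, for every $\varepsilon>0$ there is $A'\in\mathcal S(G\cup H)$ with $|a'_{ij}-a_{ij}|<\varepsilon$ for all $i,j$, such that * Case 1: $A'$ has the SSP and the same spectrum as $A$; * Case 2: $A'$ has the SMP and the same ordered multiplicity list as $A$; * Case 3: $A'$ has the SAP and the same rank as $A$. -/

import Mathlib

open scoped Matrix

noncomputable section

namespace Liberation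

/-- The graph `𝒢(A)` of a (symmetric) matrix: `i ~ j` iff `i ≠ j` and the `(i,j)` entry is nonzero. -/
def matrixGraph {n : ℕ} (A : Matrix (Fin n) (Fin n) ℝ) : SimpleGraph (Fin n) :=
  SimpleGraph.fromRel fun i j => A i j ≠ 0

/-- `𝒮(G)`: the real symmetric matrices whose graph is `G` (the diagonal is unrestricted). -/
def matricesOf {n : ℕ} (G : SimpleGraph (Fin n)) : Set (Matrix (Fin n) (Fin n) ℝ) :=
  {A | A.IsSymm ∧ matrixGraph A = G}

/-- The spectrum as a multiset: eigenvalues with their multiplicities.  It is used for real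
symmetric matrices only, for which all roots of the characteristic polynomial are real and
algebraic and geometric multiplicities agree. -/
def spec {n : ℕ} (A : Matrix (Fin n) (Fin n) ℝ) : Multiset ℝ :=
  A.charpoly.roots

/-- The distinct eigenvalues. -/
def distinctEigenvalues {n : ℕ} (A : Matrix (Fin n) (Fin n) ℝ) : Finset ℝ :=
  (spec A).toFinset

/-- The number `q(A)` of distinct eigenvalues. -/
def numEigenvalues {n : ℕ} (A : Matrix (Fin n) (Fin n) ℝ) : ℕ :=
  (distinctEigenvalues A).card

/-- The ordered multiplicity list: the multiplicities of the distinct eigenvalues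
`λ₁ < ⋯ < λ_q`, in this order. -/
def orderedMultiplicityList {n : ℕ} (A : Matrix (Fin n) (Fin n) ℝ) : List ℕ :=
  ((distinctEigenvalues A).sort (· ≤ ·)).map fun μ => (spec A).count μ

/-- Strong Spectral Property. -/
def HasSSP {n : ℕ} (A : Matrix (Fin n) (Fin n) ℝ) : Prop :=
  ∀ X : Matrix (Fin n) (Fin n) ℝ, X.IsSymm → A ⊙ X = 0 → (1 : Matrix (Fin n) (Fin n) ℝ) ⊙ X = 0 →
    A * X - X * A = 0 → X = 0

/-- Strong Multiplicity Property. -/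
def HasSMP {n : ℕ} (A : Matrix (Fin n) (Fin n) ℝ) : Prop :=
  ∀ X : Matrix (Fin n) (Fin n) ℝ, X.IsSymm → A ⊙ X = 0 → (1 : Matrix (Fin n) (Fin n) ℝ) ⊙ X = 0 →
    A * X - X * A = 0 → (∀ i : ℕ, 2 ≤ i → i < n → (A ^ i * X).trace = 0) → X = 0

/-- Strong Arnold Property. -/
def HasSAP {n : ℕ} (A : Matrix (Fin n) (Fin n) ℝ) : Prop :=
  ∀ X : Matrix (Fin n) (Fin n) ℝ, X.IsSymm → A ⊙ X = 0 → (1 : Matrix (Fin n) (Fin n) ℝ) ⊙ X = 0 →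
    A * X = 0 → X = 0

/-- Positions `(i,j)` with `i ≤ j`. -/
abbrev UpperIdx (n : ℕ) : Type := {e : Fin n × Fin n // e.1 ≤ e.2}

/-- Positions `(i,j)` with `i < j`. -/
abbrev StrictIdx (n : ℕ) : Type := {e : Fin n × Fin n // e.1 < e.2}

/-- Positions `(i,j)` with `i < j` and `{i,j}` an edge of the complement of `G`. -/
abbrev NonEdge {n : ℕ} (G : SimpleGraph (Fin n)) : Type :=
  {e : Fin n × Fin n // e.1 < e.2 ∧ Gᶜ.Adj e.1 e.2}

/-- A non-edge position as a position in the upper triangle. -/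
def NonEdge.toUpper {n : ℕ} {G : SimpleGraph (Fin n)} (e : NonEdge G) : UpperIdx n :=
  ⟨e.1, e.2.1.le⟩

/-- The vector of upper triangular entries. -/
def upperVec {n : ℕ} (M : Matrix (Fin n) (Fin n) ℝ) : UpperIdx n → ℝ :=
  fun e => M e.1.1 e.1.2

/-- The matrix unit `E_{kl}`. -/
def unitE {n : ℕ} (k l : Fin n) : Matrix (Fin n) (Fin n) ℝ :=
  Matrix.single k l 1

/-- The skew-symmetric matrix `K_{kl} = E_{kl} - E_{lk}`. -/
def skewK {n : ℕ} (k l : Fin n) : Matrix (Fin n) (Fin n) ℝ :=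
  unitE k l - unitE l k

/-- SSP tangent space matrix: the `(k,l)` column, `k < l`, is `vec (M K_{kl} + K_{lk} M)`. -/
def tangentSSP {n : ℕ} (M : Matrix (Fin n) (Fin n) ℝ) : Matrix (UpperIdx n) (StrictIdx n) ℝ :=
  Matrix.of fun e c => upperVec (M * skewK c.1.1 c.1.2 + skewK c.1.2 c.1.1 * M) e

/-- SMP tangent space matrix: the SSP tangent space matrix augmented with the columns
`vec (M ^ k)`, `k = 0, …, q - 1`. -/
def tangentSMP {n : ℕ} (M : Matrix (Fin n) (Fin n) ℝ) :
    Matrix (UpperIdx n) (StrictIdx n ⊕ Fin (numEigenvalues M)) ℝ :=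
  Matrix.fromCols (tangentSSP M) (Matrix.of fun e k => upperVec (M ^ (k : ℕ)) e)

/-- SAP tangent space matrix: the `(k,l)` column is `vec (M E_{kl} + E_{lk} M)`. -/
def tangentSAP {n : ℕ} (M : Matrix (Fin n) (Fin n) ℝ) :
    Matrix (UpperIdx n) (Fin n × Fin n) ℝ :=
  Matrix.of fun e c => upperVec (M * unitE c.1 c.2 + unitE c.2 c.1 * M) e

/-- SSP verification matrix: the non-edge rows of the SSP tangent space matrix. -/
def verificationSSP {n : ℕ} (G : SimpleGraph (Fin n)) (A : Matrix (Fin n) (Fin n) ℝ) :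
    Matrix (NonEdge G) (StrictIdx n) ℝ :=
  (tangentSSP A).submatrix NonEdge.toUpper id

/-- SMP verification matrix: the non-edge rows of the SMP tangent space matrix. -/
def verificationSMP {n : ℕ} (G : SimpleGraph (Fin n)) (A : Matrix (Fin n) (Fin n) ℝ) :
    Matrix (NonEdge G) (StrictIdx n ⊕ Fin (numEigenvalues A)) ℝ :=
  (tangentSMP A).submatrix NonEdge.toUpper id

/-- SAP verification matrix: the non-edge rows of the SAP tangent space matrix. -/
def verificationSAP {n : ℕ} (G : SimpleGraph (Fin n)) (A : Matrix (Fin n) (Fin n) ℝ) :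
    Matrix (NonEdge G) (Fin n × Fin n) ℝ :=
  (tangentSAP A).submatrix NonEdge.toUpper id

/-- `x` lies in the column space of `Ψ`, and the rows of `Ψ` indexed by the complement of the
support of `x` are linearly independent. -/
def IsLiberating {ι κ : Type*} (Ψ : Matrix ι κ ℝ) (x : ι → ℝ) : Prop :=
  x ∈ Submodule.span ℝ (Set.range Ψ.col) ∧
    LinearIndependent ℝ fun e : ((Function.support x)ᶜ : Set ι) => Ψ.row e

/-- `H` is the spanning subgraph of the complement of `G` whose edges are those corresponding
to the support of `x`. -/
def IsSupportGraph {n : ℕ} (G : SimpleGraph (Fin n)) (x : NonEdge G → ℝ)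
    (H : SimpleGraph (Fin n)) : Prop :=
  H ≤ Gᶜ ∧ ∀ e : NonEdge G, H.Adj e.1.1 e.1.2 ↔ e ∈ Function.support x

end Liberation

end

open scoped Matrix Matrix.Norms.Operator
open Filter Topology

namespace Liberation

variable {n : ℕ} {G H : SimpleGraph (Fin n)} {A : Matrix (Fin n) (Fin n) ℝ}

/-! Move `A` along a smooth family `F v` of symmetric matrices with `F 0 = A` that keeps the
spectral invariant for small `v`. The family is conjugation by `exp` of a skew matrix for the SSP,
the same applied to `A + ∑ c_k A^k` for the SMP, and congruence by `1 + Y` for the SAP. Its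
derivative at 0 has exactly the columns of `Ψ` as non-edge entries. Write `x = Ψ v₀`. Independence
of the rows off `supp x` makes the map from `v` to those entries of `F v` a submersion at 0 whose
derivative kills `v₀`. The implicit function theorem then gives a curve with velocity `v₀` along
which these entries stay zero, while the entries on `supp x` leave zero at rate `x e` and the edges
of `G` survive by continuity. Row independence is an open condition, so it persists at `A'`. It
yields the strong property by duality: a test matrix `X` lives on the non-edges of `G ⊔ H`, and its
trace-orthogonality to the tangent matrices is a linear relation among those rows
(`eq_zero_of_trace_mul_eq_zero`). `exists_liberated` packages this argument for all three cases. -/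

theorem matrixGraph_adj_of_isSymm (hA : A.IsSymm) (i j : Fin n) :
    (matrixGraph A).Adj i j ↔ i ≠ j ∧ A i j ≠ 0 := by
  simp [matrixGraph, SimpleGraph.fromRel_adj, hA.apply i j]

theorem mem_matricesOf_of_lt (hA : A.IsSymm)
    (h : ∀ i j, i < j → (A i j ≠ 0 ↔ G.Adj i j)) : A ∈ matricesOf G := by
  refine ⟨hA, ?_⟩
  ext i j
  rw [matrixGraph_adj_of_isSymm hA]
  rcases lt_trichotomy i j with hij | rfl | hij
  · simp [hij.ne, h i j hij]
  · simp
  · rw [← hA.apply i j, G.adj_comm, ← h j i hij]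
    simp [hij.ne']

theorem adj_iff_of_mem_matricesOf (hA : A ∈ matricesOf G) {i j : Fin n} (hij : i ≠ j) :
    G.Adj i j ↔ A i j ≠ 0 := by
  rw [← hA.2, matrixGraph_adj_of_isSymm hA.1]
  simp [hij]

/-- The trace of a product of two symmetric matrices, the first with zero diagonal, is twice
the sum over the upper triangle. -/
theorem trace_mul_eq_two_mul_sum_lt {X T : Matrix (Fin n) (Fin n) ℝ} (hX : X.IsSymm)
    (hT : T.IsSymm) (hd : ∀ i, X i i = 0) :
    (X * T).trace =
      2 * ∑ p : Fin n × Fin n with p.1 < p.2, X p.1 p.2 * T p.1 p.2 := by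
  set f : Fin n × Fin n → ℝ := fun p => X p.1 p.2 * T p.1 p.2 with hf
  have h1 : (X * T).trace = ∑ p, f p := by
    rw [Fintype.sum_prod_type]
    simp only [Matrix.trace, Matrix.diag_apply, Matrix.mul_apply, hf]
    exact Finset.sum_congr rfl fun i _ => Finset.sum_congr rfl fun j _ => by rw [hT.apply i j]
  -- Transposition matches the two triangles; the diagonal terms vanish because `X` has zero
  -- diagonal.
  have h2 : ∑ p : Fin n × Fin n with ¬ p.1 < p.2, f p =
      ∑ p : Fin n × Fin n with p.1 < p.2, f p := by
    symm
    refine Finset.sum_of_injOn Prod.swap Prod.swap_injective.injOn ?_ ?_ ?_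
    · intro p hp
      have h : p.1 < p.2 := by simpa using hp
      simpa using h.le
    · rintro ⟨i, j⟩ hp hp'
      have hji : j ≤ i := by simpa using hp
      rcases hji.lt_or_eq with h | rfl
      · exact absurd ⟨(j, i), by simpa using h, rfl⟩ hp'
      · simp [hf, hd]
    · intro p _
      simp [hf, hX.apply p.1 p.2, hT.apply p.1 p.2]
  rw [h1, ← Finset.sum_filter_add_sum_filter_not Finset.univ
    (fun p : Fin n × Fin n => p.1 < p.2) f, h2]
  ring

theorem IsSupportGraph.adj_sup_iff {x : NonEdge G → ℝ} (hH : IsSupportGraph G x H)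
    (e : NonEdge G) : (G ⊔ H).Adj e.1.1 e.1.2 ↔ x e ≠ 0 := by
  have := e.2.2
  rw [SimpleGraph.compl_adj] at this
  rw [SimpleGraph.sup_adj, hH.2 e]
  simp [this.2]

/-- If the non-edge rows of `T` outside the support of `x` are independent, then a symmetric
matrix with complementary pattern which is trace-orthogonal to every `T c` vanishes. -/
theorem eq_zero_of_trace_mul_eq_zero {κ : Type*} {x : NonEdge G → ℝ}
    (hH : IsSupportGraph G x H) {T : κ → Matrix (Fin n) (Fin n) ℝ} (hT : ∀ c, (T c).IsSymm)
    (hli : LinearIndependent ℝ fun (e : ((Function.support x)ᶜ : Set (NonEdge G))) (c : κ) =>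
      T c e.1.1.1 e.1.1.2)
    (hA : A ∈ matricesOf (G ⊔ H)) {X : Matrix (Fin n) (Fin n) ℝ} (hX : X.IsSymm)
    (hAX : A ⊙ X = 0) (hIX : (1 : Matrix (Fin n) (Fin n) ℝ) ⊙ X = 0)
    (htr : ∀ c, (X * T c).trace = 0) : X = 0 := by
  classical
  have hd : ∀ i, X i i = 0 := fun i => by simpa using congrFun (congrFun hIX i) i
  have hadj : ∀ i j, (G ⊔ H).Adj i j → X i j = 0 := fun i j hij => by
    have h0 := (adj_iff_of_mem_matricesOf hA hij.ne).1 hij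
    simpa [h0] using congrFun (congrFun hAX i) j
  -- The upper entries of `X` are the coefficients of a relation among the rows; positions outside
  -- the index set are edges of `G ⊔ H`, where `X` is zero.
  have hsum : ∑ e : ((Function.support x)ᶜ : Set (NonEdge G)),
      X e.1.1.1 e.1.1.2 • (fun c => T c e.1.1.1 e.1.1.2) = 0 := by
    ext c
    have h2 := trace_mul_eq_two_mul_sum_lt hX (hT c) hd
    rw [htr c, eq_comm, mul_eq_zero, or_iff_right two_ne_zero] at h2
    rw [Finset.sum_apply, Pi.zero_apply, ← h2]
    refine Finset.sum_of_injOn (fun e => e.1.1)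
      (Subtype.val_injective.comp Subtype.val_injective).injOn ?_ ?_ ?_
    · intro e _
      simpa using e.1.2.1
    · rintro ⟨i, j⟩ hp hp'
      have hij : i < j := by simpa using hp
      suffices X i j = 0 by simp [this]
      by_cases hG : (G ⊔ H).Adj i j
      · exact hadj i j hG
      · have hnG : ¬ G.Adj i j := fun h => hG (Or.inl h)
        let e : NonEdge G := ⟨(i, j), hij, by simpa [hij.ne] using hnG⟩
        exact absurd ⟨⟨e, fun h => hG ((hH.adj_sup_iff e).2 h)⟩, by simp, rfl⟩ hp'
    · intro e _
      simp
  have hz := Fintype.linearIndependent_iff.1 hli _ hsum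
  have hlt : ∀ i j, i < j → X i j = 0 := fun i j hij => by
    by_cases hG : (G ⊔ H).Adj i j
    · exact hadj i j hG
    · have hnG : ¬ G.Adj i j := fun h => hG (Or.inl h)
      let e : NonEdge G := ⟨(i, j), hij, by simpa [hij.ne] using hnG⟩
      exact hz ⟨e, fun h => hG ((hH.adj_sup_iff e).2 h)⟩
  ext i j
  rcases lt_trichotomy i j with hij | rfl | hij
  · exact hlt i j hij
  · exact hd i
  · rw [← hX.apply i j]; exact hlt j i hij

/-! ### Perturbation along a level set -/

/-- A curve with prescribed tangent vector in a level set of a submersion. -/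
theorem exists_curve_of_mem_ker {E F : Type*} [NormedAddCommGroup E] [NormedSpace ℝ E]
    [FiniteDimensional ℝ E] [NormedAddCommGroup F] [NormedSpace ℝ F] [FiniteDimensional ℝ F]
    {g : E → F} {g' : E →L[ℝ] F} {a : E} (hg : HasStrictFDerivAt g g' a)
    (hsurj : Function.Surjective g') {v : E} (hv : g' v = 0) :
    ∃ γ : ℝ → E, γ 0 = a ∧ HasDerivAt γ v 0 ∧ ∀ᶠ t in 𝓝 0, g (γ t) = g a := by
  have : CompleteSpace E := FiniteDimensional.complete ℝ E
  have : CompleteSpace F := FiniteDimensional.complete ℝ F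
  have hr : g'.range = ⊤ := LinearMap.range_eq_top.2 hsurj
  let w : g'.ker := ⟨v, hv⟩
  -- The implicit function parametrizes the level set by the kernel, with derivative the inclusion
  -- at 0; the curve is the image of the line through `w`.
  let γ : ℝ → E := fun t => hg.implicitFunction g g' hr (g a) (t • w)
  have hl : HasDerivAt (fun t : ℝ => t • w) w 0 := by
    simpa using (hasDerivAt_id (0 : ℝ)).smul_const w
  refine ⟨γ, ?_, ?_, ?_⟩
  · simp [γ]
  · have h1 := (hg.to_implicitFunction hr).hasFDerivAt
    have h2 : HasFDerivAt (hg.implicitFunction g g' hr (g a)) g'.ker.subtypeL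
        ((0 : ℝ) • w) := by simpa using h1
    exact h2.comp_hasDerivAt (0 : ℝ) hl
  · have h1 := hg.map_implicitFunction_eq hr
    have h2 : Tendsto (fun t : ℝ => (g a, t • w)) (𝓝 0) (𝓝 (g a, (0 : g'.ker))) := by
      have := hl.continuousAt.tendsto
      rw [zero_smul] at this
      exact tendsto_const_nhds.prodMk_nhds this
    exact h2.eventually h1

/-- The perturbation principle behind all three liberation statements. -/
theorem exists_liberated {κ : Type*} [Fintype κ] {x : NonEdge G → ℝ}
    (hA : A ∈ matricesOf G) (hH : IsSupportGraph G x H)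
    {T : Matrix (Fin n) (Fin n) ℝ → κ → Matrix (Fin n) (Fin n) ℝ}
    (hTc : ∀ c, Continuous fun M => T M c) (hTs : ∀ M, M.IsSymm → ∀ c, (T M c).IsSymm)
    (hx : IsLiberating (Matrix.of fun (e : NonEdge G) c => T A c e.1.1 e.1.2) x)
    {F : (κ → ℝ) → Matrix (Fin n) (Fin n) ℝ} {F' : (κ → ℝ) →L[ℝ] Matrix (Fin n) (Fin n) ℝ}
    (hF : HasStrictFDerivAt F F' 0) (hF0 : F 0 = A) (hFs : ∀ v, (F v).IsSymm)
    (hF' : ∀ v, F' v = ∑ c, v c • T A c) {P : (κ → ℝ) → Prop} (hP : ∀ᶠ v in 𝓝 0, P v)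
    {ε : ℝ} (hε : 0 < ε) :
    ∃ v, P v ∧ F v ∈ matricesOf (G ⊔ H) ∧ (∀ i j, |F v i j - A i j| < ε) ∧
      ∀ X : Matrix (Fin n) (Fin n) ℝ, X.IsSymm → F v ⊙ X = 0 →
        (1 : Matrix (Fin n) (Fin n) ℝ) ⊙ X = 0 → (∀ c, (X * T (F v) c).trace = 0) → X = 0 := by
  classical
  obtain ⟨hxs, hli⟩ := hx
  set Ψ : Matrix (NonEdge G) κ ℝ := Matrix.of fun e c => T A c e.1.1 e.1.2 with hΨ
  have hentry : ∀ v (e : NonEdge G), F' v e.1.1 e.1.2 = (Ψ *ᵥ v) e := fun v e => by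
    simp [hF', Matrix.sum_apply, Matrix.mulVec, dotProduct, hΨ, mul_comm]
  obtain ⟨v₀, hv₀⟩ : ∃ v₀, Ψ *ᵥ v₀ = x := by
    rw [← Matrix.range_mulVecLin] at hxs
    exact hxs
  let S : Set (NonEdge G) := (Function.support x)ᶜ
  -- the entries of a matrix at the positions in `S`
  let R : Matrix (Fin n) (Fin n) ℝ →L[ℝ] (S → ℝ) := LinearMap.toContinuousLinearMap
    { toFun := fun M e => M e.1.1.1 e.1.1.2
      map_add' := fun _ _ => rfl
      map_smul' := fun _ _ => rfl }
  have hR : ∀ M e, R M e = M e.1.1.1 e.1.1.2 := fun _ _ => rfl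
  let entry (i j : Fin n) : Matrix (Fin n) (Fin n) ℝ →L[ℝ] ℝ :=
    LinearMap.toContinuousLinearMap (Matrix.entryLinearMap ℝ ℝ i j)
  have hentry' : ∀ i j M, entry i j M = M i j := fun _ _ _ => rfl
  have hg : HasStrictFDerivAt (fun v => R (F v)) (R ∘L F') 0 := R.hasStrictFDerivAt.comp 0 hF
  have hsurj : Function.Surjective (R ∘L F') := by
    have hli' : LinearIndependent ℝ (Ψ.submatrix (Subtype.val : S → NonEdge G) id).row := hli
    have hrk := hli'.rank_matrix
    -- Full row rank means surjectivity.
    have htop : (Ψ.submatrix (Subtype.val : S → NonEdge G) id).mulVecLin.range = ⊤ := by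
      apply Submodule.eq_top_of_finrank_eq
      rw [← Matrix.rank, hrk, Module.finrank_fintype_fun_eq_card]
    intro y
    obtain ⟨v, hv⟩ := LinearMap.range_eq_top.1 htop y
    refine ⟨v, ?_⟩
    ext e
    rw [← hv]
    exact hentry v e.1
  have hker : (R ∘L F') v₀ = 0 := by
    ext e
    change F' v₀ e.1.1.1 e.1.1.2 = 0
    rw [hentry, hv₀]
    exact Function.notMem_support.1 e.2
  obtain ⟨γ, hγ0, hγ', hγ⟩ := exists_curve_of_mem_ker hg hsurj hker
  have hγc : Tendsto γ (𝓝 0) (𝓝 0) := by simpa [hγ0] using hγ'.continuousAt.tendsto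
  have hFγ : Tendsto (fun t => F (γ t)) (𝓝 0) (𝓝 A) := by
    have := hF.continuousAt.tendsto
    rw [hF0] at this
    exact this.comp hγc
  have hFe : ∀ i j, Tendsto (fun t => F (γ t) i j) (𝓝 0) (𝓝 (A i j)) := fun i j =>
    ((entry i j).continuous.tendsto A).comp hFγ
  have hclose : ∀ᶠ t in 𝓝 (0 : ℝ), ∀ i j, |F (γ t) i j - A i j| < ε := by
    rw [eventually_all]; intro i
    rw [eventually_all]; intro j
    filter_upwards [(hFe i j).eventually (Metric.ball_mem_nhds (A i j) hε)] with t ht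
    simpa [Real.dist_eq] using ht
  have hedge : ∀ᶠ t in 𝓝 (0 : ℝ), ∀ i j, A i j ≠ 0 → F (γ t) i j ≠ 0 := by
    rw [eventually_all]; intro i
    rw [eventually_all]; intro j
    by_cases h : A i j = 0
    · simp [h]
    · filter_upwards [(hFe i j).eventually_ne h] with t ht _ using ht
  -- Only a punctured neighbourhood works: the entry is zero at `t = 0` and has derivative `x e ≠ 0`
  -- there.
  have hsupp : ∀ᶠ t in 𝓝[≠] (0 : ℝ), ∀ e : NonEdge G, x e ≠ 0 → F (γ t) e.1.1 e.1.2 ≠ 0 := by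
    rw [eventually_all]; intro e
    by_cases h : x e = 0
    · simp [h]
    · have h1 : HasFDerivAt F F' (γ 0) := by rw [hγ0]; exact hF.hasFDerivAt
      have h2 := (h1.comp_hasDerivAt (0 : ℝ) hγ')
      have h3 := (entry e.1.1 e.1.2).hasFDerivAt.comp_hasDerivAt (0 : ℝ) h2
      have h4 : entry e.1.1 e.1.2 (F' v₀) ≠ 0 := by rw [hentry', hentry, hv₀]; exact h
      filter_upwards [h3.eventually_ne (c := 0) h4] with t ht _ using ht
  have hrows : ∀ᶠ t in 𝓝 (0 : ℝ), LinearIndependent ℝ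
      fun (e : S) (c : κ) => T (F (γ t)) c e.1.1.1 e.1.1.2 := by
    have hcont : Continuous fun (M : Matrix (Fin n) (Fin n) ℝ) (e : S) (c : κ) =>
        T M c e.1.1.1 e.1.1.2 := by
      refine continuous_pi fun e => continuous_pi fun c => ?_
      exact (entry e.1.1.1 e.1.1.2).continuous.comp (hTc c)
    exact ((hcont.tendsto A).comp hFγ).eventually
      (isOpen_setOfPred_linearIndependent.mem_nhds hli)
  have hPt := hγc.eventually hP
  obtain ⟨t, ht, hte⟩ := ((hclose.and (hedge.and (hrows.and (hPt.and hγ)))).filter_mono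
    nhdsWithin_le_nhds |>.and hsupp).exists
  obtain ⟨h1, h2, h3, h4, h5⟩ := ht
  have hmem : F (γ t) ∈ matricesOf (G ⊔ H) := by
    refine mem_matricesOf_of_lt (hFs _) fun i j hij => ?_
    by_cases hG : G.Adj i j
    · have := h2 i j ((adj_iff_of_mem_matricesOf hA hij.ne).1 hG)
      simp [this, hG]
    · let e : NonEdge G := ⟨(i, j), hij, by simpa [hij.ne] using hG⟩
      rw [hH.adj_sup_iff e]
      refine ⟨fun h hxe => h ?_, hte e⟩
      -- Off the support, the entry is constant along the curve, hence equal to that of `A`, which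
      -- is zero at a non-edge.
      have h6 : R (F (γ t)) ⟨e, by simpa [S] using hxe⟩ = R (F 0) ⟨e, by simpa [S] using hxe⟩ :=
        congrFun h5 _
      rw [hR, hR, hF0] at h6
      refine h6.trans ?_
      by_contra h0
      exact hG ((adj_iff_of_mem_matricesOf hA hij.ne).2 h0)
  exact ⟨γ t, h4, hmem, h1, fun X hX hAX hIX htr =>
    eq_zero_of_trace_mul_eq_zero hH (hTs _ (hFs _)) h3 hmem hX hAX hIX htr⟩

/-! ### Orthogonal conjugation and the SSP -/

theorem transpose_skewK (k l : Fin n) : (skewK k l)ᵀ = skewK l k := by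
  simp [skewK, unitE]

theorem neg_skewK (k l : Fin n) : -skewK k l = skewK l k := by
  simp [skewK]

/-- The skew-symmetric matrix with the given entries above the diagonal. -/
noncomputable def skewOf : (StrictIdx n → ℝ) →L[ℝ] Matrix (Fin n) (Fin n) ℝ :=
  LinearMap.toContinuousLinearMap
    (Fintype.linearCombination ℝ fun c : StrictIdx n => skewK c.1.1 c.1.2)

theorem skewOf_apply (v : StrictIdx n → ℝ) :
    skewOf v = ∑ c, v c • skewK c.1.1 c.1.2 := rfl

theorem transpose_skewOf (v : StrictIdx n → ℝ) : (skewOf v)ᵀ = -skewOf v := by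
  rw [skewOf_apply, Matrix.transpose_sum, ← Finset.sum_neg_distrib]
  exact Finset.sum_congr rfl fun c _ => by
    rw [Matrix.transpose_smul, transpose_skewK, ← neg_skewK, smul_neg]

/-- The matrix `M K_{kl} + K_{lk} M`. -/
noncomputable def skewTangent (M : Matrix (Fin n) (Fin n) ℝ) (c : StrictIdx n) : Matrix (Fin n) (Fin n) ℝ :=
  M * skewK c.1.1 c.1.2 + skewK c.1.2 c.1.1 * M

theorem continuous_skewTangent (c : StrictIdx n) : Continuous fun M => skewTangent M c := by
  unfold skewTangent; fun_prop

theorem isSymm_skewTangent (hA : A.IsSymm) (c : StrictIdx n) : (skewTangent A c).IsSymm := by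
  simp [Matrix.IsSymm, skewTangent, transpose_skewK, hA.eq, add_comm]

theorem sum_smul_skewTangent (A : Matrix (Fin n) (Fin n) ℝ) (v : StrictIdx n → ℝ) :
    ∑ c, v c • skewTangent A c = A * skewOf v - skewOf v * A := by
  rw [skewOf_apply, Finset.mul_sum, Finset.sum_mul, ← Finset.sum_sub_distrib]
  exact Finset.sum_congr rfl fun c _ => by
    rw [skewTangent, ← neg_skewK c.1.1, mul_smul_comm, smul_mul_assoc, neg_mul, ← sub_eq_add_neg,
      smul_sub]

/-- By cyclicity, `tr (X (A K - K A)) = tr ((X A - A X) K)`. -/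
theorem trace_mul_skewTangent {X : Matrix (Fin n) (Fin n) ℝ} (h : A * X - X * A = 0)
    (c : StrictIdx n) : (X * skewTangent A c).trace = 0 := by
  rw [skewTangent, ← neg_skewK c.1.1, mul_add, Matrix.trace_add, neg_mul, mul_neg,
    Matrix.trace_neg, ← mul_assoc, ← mul_assoc, Matrix.trace_mul_cycle X (skewK _ _),
    sub_eq_zero.1 h, add_neg_cancel]

theorem isSymm_exp_conj {B : Matrix (Fin n) (Fin n) ℝ} (hB : B.IsSymm) (v : StrictIdx n → ℝ) :
    (NormedSpace.exp (-skewOf v) * B * NormedSpace.exp (skewOf v)).IsSymm := by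
  rw [Matrix.IsSymm, Matrix.transpose_mul, Matrix.transpose_mul, ← Matrix.exp_transpose,
    ← Matrix.exp_transpose, Matrix.transpose_neg, transpose_skewOf, neg_neg, hB.eq, mul_assoc]

theorem charpoly_exp_conj (K B : Matrix (Fin n) (Fin n) ℝ) :
    (NormedSpace.exp (-K) * B * NormedSpace.exp K).charpoly = B.charpoly := by
  obtain ⟨u, hu⟩ := Matrix.isUnit_exp K
  rw [Matrix.exp_neg, ← hu]
  simpa only [Matrix.coe_units_inv] using Matrix.charpoly_units_conj' u B

/-- Product rule, with the derivative of `exp` at 0 being the identity. The middle factor may vary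
so that the SMP family is covered too. -/
theorem hasStrictFDerivAt_exp_conj {E : Type*} [NormedAddCommGroup E] [NormedSpace ℝ E]
    (K : E →L[ℝ] Matrix (Fin n) (Fin n) ℝ) {B : E → Matrix (Fin n) (Fin n) ℝ}
    {B' : E →L[ℝ] Matrix (Fin n) (Fin n) ℝ} (hB : HasStrictFDerivAt B B' 0) :
    ∃ D : E →L[ℝ] Matrix (Fin n) (Fin n) ℝ,
      HasStrictFDerivAt (fun v => NormedSpace.exp (-K v) * B v * NormedSpace.exp (K v)) D 0 ∧
      ∀ v, D v = B 0 * K v - K v * B 0 + B' v := by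
  have he : HasStrictFDerivAt (fun v => NormedSpace.exp (K v)) K 0 := by
    have h0 : HasStrictFDerivAt (NormedSpace.exp : Matrix (Fin n) (Fin n) ℝ → _)
      (1 : Matrix (Fin n) (Fin n) ℝ →L[ℝ] _) (K 0) := by
      rw [map_zero]; exact hasStrictFDerivAt_exp_zero
    exact h0.comp 0 K.hasStrictFDerivAt
  have he' : HasStrictFDerivAt (fun v => NormedSpace.exp (-K v)) (-K) 0 := by
    have h0 : HasStrictFDerivAt (NormedSpace.exp : Matrix (Fin n) (Fin n) ℝ → _)
      (1 : Matrix (Fin n) (Fin n) ℝ →L[ℝ] _) ((-K) 0) := by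
      rw [map_zero]; exact hasStrictFDerivAt_exp_zero
    exact h0.comp 0 (-K).hasStrictFDerivAt
  refine ⟨_, (he'.mul' hB).mul' he, fun v => ?_⟩
  change NormedSpace.exp (-K 0) * B 0 * K v +
    (NormedSpace.exp (-K 0) * B' v + -K v * B 0) * NormedSpace.exp (K 0) = _
  simp only [map_zero, neg_zero, NormedSpace.exp_zero, one_mul, mul_one, neg_mul]
  abel

theorem liberation_ssp (hA : A ∈ matricesOf G) {x : NonEdge G → ℝ} (hH : IsSupportGraph G x H)
    (hx : IsLiberating (verificationSSP G A) x) {ε : ℝ} (hε : 0 < ε) :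
    ∃ A' ∈ matricesOf (G ⊔ H), (∀ i j, |A' i j - A i j| < ε) ∧ HasSSP A' ∧ spec A' = spec A := by
  obtain ⟨D, hD, hD'⟩ := hasStrictFDerivAt_exp_conj (skewOf (n := n))
    (hasStrictFDerivAt_const A 0)
  obtain ⟨v, -, hv, hc, hX⟩ := exists_liberated (T := skewTangent) (P := fun _ => True) hA hH
    continuous_skewTangent (fun M hM => isSymm_skewTangent hM) hx hD
    (by simp [NormedSpace.exp_zero]) (fun v => isSymm_exp_conj hA.1 v)
    (fun v => by rw [hD', sum_smul_skewTangent]; simp) (by simp) hε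
  refine ⟨_, hv, hc, fun X h1 h2 h3 h4 => hX X h1 h2 h3 (trace_mul_skewTangent h4), ?_⟩
  rw [spec, charpoly_exp_conj, spec]

/-! ### Congruence and the SAP -/

/-- The matrix `M E_{kl} + E_{lk} M`. -/
noncomputable def unitTangent (M : Matrix (Fin n) (Fin n) ℝ) (c : Fin n × Fin n) :
    Matrix (Fin n) (Fin n) ℝ :=
  M * unitE c.1 c.2 + unitE c.2 c.1 * M

theorem transpose_unitE (k l : Fin n) : (unitE k l)ᵀ = unitE l k := by
  simp [unitE]

/-- The matrix with the given entries. -/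
noncomputable def fullOf : (Fin n × Fin n → ℝ) →L[ℝ] Matrix (Fin n) (Fin n) ℝ :=
  LinearMap.toContinuousLinearMap
    (Fintype.linearCombination ℝ fun c : Fin n × Fin n => unitE c.1 c.2)

/-- The transpose of the matrix with the given entries. -/
noncomputable def fullOfTranspose : (Fin n × Fin n → ℝ) →L[ℝ] Matrix (Fin n) (Fin n) ℝ :=
  LinearMap.toContinuousLinearMap
    (Fintype.linearCombination ℝ fun c : Fin n × Fin n => unitE c.2 c.1)

theorem transpose_fullOf (v : Fin n × Fin n → ℝ) : (fullOf v)ᵀ = fullOfTranspose v := by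
  change (∑ c, v c • unitE c.1 c.2)ᵀ = ∑ c, v c • unitE c.2 c.1
  simp [Matrix.transpose_sum, transpose_unitE]

theorem sum_smul_unitTangent (A : Matrix (Fin n) (Fin n) ℝ) (v : Fin n × Fin n → ℝ) :
    ∑ c, v c • unitTangent A c = A * fullOf v + fullOfTranspose v * A := by
  change _ = A * (∑ c, v c • unitE c.1 c.2) + (∑ c, v c • unitE c.2 c.1) * A
  simp [unitTangent, Finset.mul_sum, Finset.sum_mul, Finset.sum_add_distrib, smul_add]

theorem trace_mul_unitTangent {X : Matrix (Fin n) (Fin n) ℝ} (hA : A.IsSymm) (hX : X.IsSymm)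
    (h : A * X = 0) (c : Fin n × Fin n) : (X * unitTangent A c).trace = 0 := by
  have h' : X * A = 0 := by
    rw [← hX.eq, ← hA.eq, ← Matrix.transpose_mul, h, Matrix.transpose_zero]
  rw [unitTangent, mul_add, Matrix.trace_add, ← mul_assoc, ← mul_assoc, h',
    Matrix.trace_mul_cycle X, h]
  simp

theorem liberation_sap (hA : A ∈ matricesOf G) {x : NonEdge G → ℝ} (hH : IsSupportGraph G x H)
    (hx : IsLiberating (verificationSAP G A) x) {ε : ℝ} (hε : 0 < ε) :
    ∃ A' ∈ matricesOf (G ⊔ H), (∀ i j, |A' i j - A i j| < ε) ∧ HasSAP A' ∧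
      A'.rank = A.rank := by
  obtain ⟨D, hD, hD'⟩ : ∃ D : (Fin n × Fin n → ℝ) →L[ℝ] Matrix (Fin n) (Fin n) ℝ,
      HasStrictFDerivAt (fun v => (1 + fullOfTranspose v) * A * (1 + fullOf v)) D 0 ∧
      ∀ v, D v = A * fullOf v + fullOfTranspose v * A := by
    refine ⟨_, (((fullOfTranspose (n := n)).hasStrictFDerivAt (x := 0)).const_add 1 |>.mul'
      (hasStrictFDerivAt_const A 0)).mul' ((fullOf (n := n)).hasStrictFDerivAt.const_add 1),
      fun v => ?_⟩
    change (1 + fullOfTranspose 0) * A * fullOf v +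
      ((1 + fullOfTranspose 0) * 0 + fullOfTranspose v * A) * (1 + fullOf 0) = _
    simp
  -- Congruence preserves rank only while `1 + fullOf v` is invertible, which holds near 0.
  have hP : ∀ᶠ v in 𝓝 (0 : Fin n × Fin n → ℝ), IsUnit (1 + fullOf v).det := by
    have hc : Continuous fun v : Fin n × Fin n → ℝ => (1 + fullOf v).det :=
      (continuous_const.add fullOf.continuous).matrix_det
    filter_upwards [hc.continuousAt.eventually_ne (x := 0) (y := 0) (by simp)] with v hv
    exact hv.isUnit
  obtain ⟨v, hu, hv, hc, hX⟩ := exists_liberated (T := unitTangent) hA hH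
    (fun c => by unfold unitTangent; fun_prop)
    (fun M hM c => by simp [Matrix.IsSymm, unitTangent, transpose_unitE, hM.eq, add_comm])
    hx hD (by simp)
    (fun v => by simp [Matrix.IsSymm, ← transpose_fullOf, hA.1.eq, mul_assoc])
    (fun v => by rw [sum_smul_unitTangent, hD']) hP hε
  refine ⟨_, hv, hc, fun X h1 h2 h3 h4 => hX X h1 h2 h3 fun c => ?_, ?_⟩
  · exact trace_mul_unitTangent hv.1 h1 h4 c
  · have hu' : IsUnit (1 + fullOfTranspose v).det := by
      rw [← transpose_fullOf, ← Matrix.transpose_one, ← Matrix.transpose_add,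
        Matrix.det_transpose]
      exact hu
    rw [Matrix.rank_mul_eq_left_of_isUnit_det _ _ hu, Matrix.rank_mul_eq_right_of_isUnit_det _ _ hu']

/-! ### Polynomial perturbation of the spectrum and the SMP -/

/-- A small polynomial perturbation of the identity acts on the spectrum of a symmetric matrix. -/
theorem spec_add_sum_smul_pow (hA : A.IsSymm) {q : ℕ} (c : Fin q → ℝ) :
    spec (A + ∑ k, c k • A ^ (k : ℕ)) =
      (spec A).map fun t => t + ∑ k : Fin q, c k * t ^ (k : ℕ) := by
  have hH : A.IsHermitian := by
    rw [Matrix.IsHermitian, Matrix.conjTranspose_eq_transpose_of_trivial]; exact hA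
  set f : ℝ → ℝ := fun t => t + ∑ k : Fin q, c k * t ^ (k : ℕ) with hf
  set φ := Unitary.conjStarAlgAut ℝ (Matrix (Fin n) (Fin n) ℝ) hH.eigenvectorUnitary with hφ
  have hAd : A = φ (Matrix.diagonal hH.eigenvalues) := hH.spectral_theorem
  have hB : A + ∑ k, c k • A ^ (k : ℕ) = φ (Matrix.diagonal (f ∘ hH.eigenvalues)) := by
    have h1 : A + ∑ k, c k • A ^ (k : ℕ) = φ (Matrix.diagonal hH.eigenvalues +
        ∑ k, c k • Matrix.diagonal hH.eigenvalues ^ (k : ℕ)) := by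
      simp only [map_add, map_sum, map_smul, map_pow, ← hAd]
    rw [h1]
    congr 1
    ext i j
    by_cases hij : i = j
    · subst hij
      simp [Matrix.sum_apply, Matrix.diagonal_pow, hf]
    · simp [Matrix.sum_apply, Matrix.diagonal_pow, hij]
  rw [spec, spec, hH.roots_charpoly_eq_eigenvalues, hB, hφ, Unitary.conjStarAlgAut_apply,
    Matrix.charpoly_mul_comm, ← mul_assoc]
  simp only [Unitary.coe_star_mul_self, one_mul, Matrix.charpoly_diagonal]
  rw [Polynomial.roots_prod _ _ (by simp [Finset.prod_ne_zero_iff, Polynomial.X_sub_C_ne_zero])]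
  simp only [Polynomial.roots_X_sub_C, Multiset.bind_singleton, Multiset.map_map]
  rfl

/-- Being increasing on the eigenvalues, `f` carries the sorted list to the sorted list; being
injective there, it preserves counts. -/
theorem orderedMultiplicityList_of_spec_eq_map {B : Matrix (Fin n) (Fin n) ℝ} {f : ℝ → ℝ}
    (hf : StrictMonoOn f (distinctEigenvalues A)) (h : spec B = (spec A).map f) :
    orderedMultiplicityList B = orderedMultiplicityList A := by
  have hd : distinctEigenvalues B = (distinctEigenvalues A).image f := by
    ext; simp [distinctEigenvalues, h]
  have hs : (distinctEigenvalues B).sort (· ≤ ·) =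
      ((distinctEigenvalues A).sort (· ≤ ·)).map f := by
    refine List.Perm.eq_of_pairwise' (r := (· ≤ ·)) (Finset.pairwise_sort _ _) ?_ ?_
    · rw [List.pairwise_map]
      exact (Finset.pairwise_sort (distinctEigenvalues A) (· ≤ ·)).imp_of_mem fun ha hb hab =>
        hf.monotoneOn (by simpa using ha) (by simpa using hb) hab
    · refine (List.perm_ext_iff_of_nodup (Finset.sort_nodup _ _) ?_).2 fun a => by simp [hd]
      exact (Finset.sort_nodup _ _).map_on fun a ha b hb hab =>
        hf.injOn (by simpa using ha) (by simpa using hb) hab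
  rw [orderedMultiplicityList, orderedMultiplicityList, hs, List.map_map]
  refine List.map_congr_left fun μ hμ => ?_
  have hμ' : μ ∈ distinctEigenvalues A := by simpa using hμ
  rw [Function.comp_apply, h]
  exact Multiset.count_map_eq_count f _ (fun a ha b hb hab => hf.injOn
    (by simpa [distinctEigenvalues] using ha) (by simpa [distinctEigenvalues] using hb) hab) μ
    (by simpa [distinctEigenvalues] using hμ')

/-- A small polynomial perturbation of the identity is increasing on a given finite set. -/
theorem eventually_strictMonoOn_add_sum_mul_pow (s : Finset ℝ) (q : ℕ) :
    ∀ᶠ c in 𝓝 (0 : Fin q → ℝ), StrictMonoOn (fun t => t + ∑ k : Fin q, c k * t ^ (k : ℕ)) (s : Set ℝ) := by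
  have h : ∀ᶠ c in 𝓝 (0 : Fin q → ℝ), ∀ a ∈ s, ∀ b ∈ s, a < b →
      a + ∑ k : Fin q, c k * a ^ (k : ℕ) < b + ∑ k : Fin q, c k * b ^ (k : ℕ) := by
    rw [eventually_all_finset]; intro a _
    rw [eventually_all_finset]; intro b _
    by_cases hab : a < b
    · have h1 : ∀ t : ℝ, Continuous fun c : Fin q → ℝ => t + ∑ k : Fin q, c k * t ^ (k : ℕ) :=
        fun t => by fun_prop
      filter_upwards [(h1 a).continuousAt.eventually_lt (h1 b).continuousAt
        (x₀ := 0) (by simpa using hab)] with c hc _ using hc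
    · simp [hab]
  filter_upwards [h] with c hc a ha b hb hab using hc a ha b hb hab

theorem liberation_smp (hA : A ∈ matricesOf G) {x : NonEdge G → ℝ} (hH : IsSupportGraph G x H)
    (hx : IsLiberating (verificationSMP G A) x) {ε : ℝ} (hε : 0 < ε) :
    ∃ A' ∈ matricesOf (G ⊔ H), (∀ i j, |A' i j - A i j| < ε) ∧ HasSMP A' ∧
      orderedMultiplicityList A' = orderedMultiplicityList A := by
  set q := numEigenvalues A with hq
  -- Ensures that the powers `k < q` used as tangents fall within the range `i < n` of the SMP trace
  -- conditions.
  have hqn : q ≤ n := by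
    refine (Multiset.toFinset_card_le _).trans ((Polynomial.card_roots' _).trans ?_)
    simp
  let T (M : Matrix (Fin n) (Fin n) ℝ) : StrictIdx n ⊕ Fin q → Matrix (Fin n) (Fin n) ℝ :=
    Sum.elim (skewTangent M) fun k => M ^ (k : ℕ)
  let l : (StrictIdx n ⊕ Fin q → ℝ) →L[ℝ] (StrictIdx n → ℝ) :=
    ContinuousLinearMap.pi fun c => ContinuousLinearMap.proj (Sum.inl c)
  let r : (StrictIdx n ⊕ Fin q → ℝ) →L[ℝ] (Fin q → ℝ) :=
    ContinuousLinearMap.pi fun c => ContinuousLinearMap.proj (Sum.inr c)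
  let B' : (StrictIdx n ⊕ Fin q → ℝ) →L[ℝ] Matrix (Fin n) (Fin n) ℝ :=
    LinearMap.toContinuousLinearMap
      (Fintype.linearCombination ℝ fun k : Fin q => A ^ (k : ℕ)) ∘L r
  have hB' : ∀ v, B' v = ∑ k, v (Sum.inr k) • A ^ (k : ℕ) := fun _ => rfl
  have hBs : ∀ v, (A + B' v).IsSymm := fun v => by
    simp [Matrix.IsSymm, hB', Matrix.transpose_sum, Matrix.transpose_pow, hA.1.eq]
  obtain ⟨D, hD, hD'⟩ := hasStrictFDerivAt_exp_conj (skewOf (n := n) ∘L l)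
    (B'.hasStrictFDerivAt (x := 0) |>.const_add A)
  have hx' : IsLiberating (Matrix.of fun (e : NonEdge G) c => T A c e.1.1 e.1.2) x := by
    convert hx using 1
    ext e c
    rcases c with c | c <;> rfl
  obtain ⟨v, hm, hv, hc, hX⟩ := exists_liberated (T := T) hA hH
    (by
      rintro (c | k)
      · exact continuous_skewTangent c
      · exact continuous_pow (k : ℕ))
    (by
      rintro M hM (c | k)
      · exact isSymm_skewTangent hM c
      · exact hM.pow k)
    hx' hD (by simp [NormedSpace.exp_zero]) (fun v => isSymm_exp_conj (hBs v) (l v))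
    (fun v => by
      rw [hD', Fintype.sum_sum_type]
      simp only [T, Sum.elim_inl, Sum.elim_inr]
      rw [show ∑ c, v (Sum.inl c) • skewTangent A c = _ from sum_smul_skewTangent A (l v),
        map_zero, add_zero]
      rw [hB' v]
      rfl)
    ((r.continuous.tendsto' 0 0 (map_zero _)).eventually
      (eventually_strictMonoOn_add_sum_mul_pow (distinctEigenvalues A) q)) hε
  refine ⟨_, hv, hc, fun X h1 h2 h3 h4 h5 => hX X h1 h2 h3 ?_, ?_⟩
  · have hd : ∀ i, X i i = 0 := fun i => by simpa using congrFun (congrFun h3 i) i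
    rintro (c | k)
    · exact trace_mul_skewTangent h4 c
    · obtain ⟨k, hk⟩ := k
      change (X * _ ^ k).trace = 0
      -- The SMP has no trace condition for exponents 0 and 1: these follow from the zero diagonal
      -- of `X` and from `A' ⊙ X = 0`.
      match k, hk with
      | 0, _ => simp [Matrix.trace, hd]
      | 1, _ =>
        rw [pow_one, trace_mul_eq_two_mul_sum_lt h1 hv.1 hd]
        rw [Finset.sum_eq_zero fun p _ => (mul_comm _ _).trans (congrFun (congrFun h2 p.1) p.2),
          mul_zero]
      | k + 2, hk =>
        rw [Matrix.trace_mul_comm]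
        exact h5 (k + 2) (by omega) (by omega)
  · refine orderedMultiplicityList_of_spec_eq_map hm ?_
    rw [spec, charpoly_exp_conj]
    exact spec_add_sum_smul_pow hA.1 _

end Liberation


theorem mainTheorem7 (n : ℕ) (G : SimpleGraph (Fin n)) (A : Matrix (Fin n) (Fin n) ℝ)
    (hA : A ∈ Liberation.matricesOf G) (x : Liberation.NonEdge G → ℝ)
    (H : SimpleGraph (Fin n)) (hH : Liberation.IsSupportGraph G x H) :
    (Liberation.IsLiberating (Liberation.verificationSSP G A) x →
      ∀ ε : ℝ, 0 < ε → ∃ A' ∈ Liberation.matricesOf (G ⊔ H),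
        (∀ i j, |A' i j - A i j| < ε) ∧
        Liberation.HasSSP A' ∧ Liberation.spec A' = Liberation.spec A) ∧
    (Liberation.IsLiberating (Liberation.verificationSMP G A) x →
      ∀ ε : ℝ, 0 < ε → ∃ A' ∈ Liberation.matricesOf (G ⊔ H),
        (∀ i j, |A' i j - A i j| < ε) ∧
        Liberation.HasSMP A' ∧
          Liberation.orderedMultiplicityList A' = Liberation.orderedMultiplicityList A) ∧
    (Liberation.IsLiberating (Liberation.verificationSAP G A) x →
      ∀ ε : ℝ, 0 < ε → ∃ A' ∈ Liberation.matricesOf (G ⊔ H),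
        (∀ i j, |A' i j - A i j| < ε) ∧
        Liberation.HasSAP A' ∧ A'.rank = A.rank) := by
  exact ⟨fun hx ε hε => Liberation.liberation_ssp hA hH hx hε,
    fun hx ε hε => Liberation.liberation_smp hA hH hx hε,
    fun hx ε hε => Liberation.liberation_sap hA hH hx hε⟩
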